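/- Let $d\ge 1$ be an integer, let $\mathbb N=\{1,2,\dots\}$, and for $v\in\mathbb R^d$ let $\|v\|$ denote the sup-norm distance from $v$ to $\mathbb Z^d$. Let $\mathcal D$ be the set of all non-increasing functions $\psi:\mathbb N\to\mathbb R_{\ge 0}$ such that $\sum_{n\in\mathbb N}\psi(n)^d$ diverges. For $\psi:\mathbb N\to\mathbb R_{\ge 0}$ put $$W(\psi)=\{(x,y)\in\mathbb R^d\times\mathbb R^d : \|nx+y\|<\psi(n)\text{ for infinitely many } n\in\mathbb N\},$$ and let $$\Pi=\bigcap_{\psi\in\mathcal D}W(\psi),\qquad \Phi(x)=\{y\in\mathbb R^d : (x,y)\in\Pi\}\quad(x\in\mathbb R^d).$$ Then $\Pi$ is coanalytic (the complement of an analytic set), it is Lebesgue measurable, and it has $2d$-dimensional Lebesgue measure $0$. In fact, for every $x\in\mathbb R^d$, the set $\Phi(x)$ is coanalytic, Lebesgue measurable, and has $d$-dimensional Lebesgue measure $0$. -/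

import Mathlib

open scoped NNReal

namespace InhomApprox

/-- The integer lattice `ℤ^d` as a subset of `ℝ^d`. -/
def intLattice (d : ℕ) : Set (Fin d → ℝ) :=
  Set.range fun (k : Fin d → ℤ) (i : Fin d) => (k i : ℝ)

/-- Distance from `v ∈ ℝ^d` to `ℤ^d` in the sup-norm (the metric of `Fin d → ℝ`). -/
noncomputable def distInt {d : ℕ} (v : Fin d → ℝ) : ℝ :=
  Metric.infDist v (intLattice d)

/-- `W(ψ)`: the pairs `(x, y)` such that `‖n x + y‖ < ψ(n)` for infinitely many positive
integers `n`. -/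
def W {d : ℕ} (ψ : ℕ+ → ℝ≥0) : Set ((Fin d → ℝ) × (Fin d → ℝ)) :=
  {p | {n : ℕ+ | distInt (((n : ℕ) : ℝ) • p.1 + p.2) < (ψ n : ℝ)}.Infinite}

/-- `𝒟`: the non-increasing `ψ : ℕ → ℝ_{≥ 0}` such that `∑ ψ(n)^d` diverges. -/
def divergentRates (d : ℕ) : Set (ℕ+ → ℝ≥0) :=
  {ψ | Antitone ψ ∧ ¬ Summable fun n => ψ n ^ d}

/-- `Π = ⋂_{ψ ∈ 𝒟} W(ψ)`. -/
def bigPi (d : ℕ) : Set ((Fin d → ℝ) × (Fin d → ℝ)) :=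
  ⋂ ψ ∈ divergentRates d, W ψ

/-- `Φ(x) = {y : (x, y) ∈ Π}`, the vertical fiber of `Π` over `x`. -/
def Phi {d : ℕ} (x : Fin d → ℝ) : Set (Fin d → ℝ) :=
  {y | (x, y) ∈ bigPi d}

end InhomApprox

open MeasureTheory Metric Filter Topology

namespace InhomApprox

variable {d : ℕ}

/-! A point `p` lies outside `W ψ` iff `ψ n ≤ affDist p n` from some `N` on; for antitone `ψ` this
means `ψ ≤ minDist N p` there. So only the rates `minDist N p` need testing (`mem_bigPi_iff`), and
`bigPi d` is Borel. For nullity, monotonicity and summability force `n * minDist 1 p n ^ d → 0`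
along powers of two. In a fixed ball, the `y` with this quantity below `c` have volume `O(c)`,
uniformly in `n` (`volume_mul_minDist_pow_lt_le`). Let `c → 0`. -/

/-- The distance of `n x + y` to `ℤ^d`, as a nonnegative real. -/
noncomputable def affDist (p : (Fin d → ℝ) × (Fin d → ℝ)) (n : ℕ+) : ℝ≥0 :=
  infNndist (((n : ℕ) : ℝ) • p.1 + p.2) (intLattice d)

lemma coe_affDist (p : (Fin d → ℝ) × (Fin d → ℝ)) (n : ℕ+) :
    (affDist p n : ℝ) = distInt (((n : ℕ) : ℝ) • p.1 + p.2) := rfl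

lemma continuous_affDist (n : ℕ+) :
    Continuous fun p : (Fin d → ℝ) × (Fin d → ℝ) => affDist p n :=
  (continuous_infNndist_pt (intLattice d)).comp (by fun_prop)

/-- The largest non-increasing function of `n` that is bounded by `affDist p n` for `N ≤ n`. -/
noncomputable def minDist (N : ℕ+) (p : (Fin d → ℝ) × (Fin d → ℝ)) (n : ℕ+) : ℝ≥0 :=
  -- `max` keeps the interval nonempty; for `n < N` the value is `affDist p N`.
  (Finset.Icc N (max N n)).inf' (Finset.nonempty_Icc.2 (le_max_left N n)) (affDist p)

lemma antitone_minDist (N : ℕ+) (p : (Fin d → ℝ) × (Fin d → ℝ)) : Antitone (minDist N p) :=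
  fun _ _ h => Finset.inf'_mono _ (Finset.Icc_subset_Icc_right (max_le_max_left N h)) _

lemma minDist_le_affDist {N n : ℕ+} (h : N ≤ n) (p : (Fin d → ℝ) × (Fin d → ℝ)) :
    minDist N p n ≤ affDist p n :=
  Finset.inf'_le _ (Finset.mem_Icc.2 ⟨h, le_max_right N n⟩)

lemma continuous_minDist (N n : ℕ+) :
    Continuous fun p : (Fin d → ℝ) × (Fin d → ℝ) => minDist N p n :=
  Continuous.finset_inf'_apply _ fun m _ => continuous_affDist m

lemma notMem_W_of_minDist_le (N : ℕ+) (p : (Fin d → ℝ) × (Fin d → ℝ)) :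
    p ∉ W (minDist N p) := by
  refine Set.not_infinite.2 ((Set.finite_Iio N).subset fun n hn => ?_)
  by_contra h
  have h1 := minDist_le_affDist (not_lt.1 h) p
  rw [← NNReal.coe_le_coe, coe_affDist] at h1
  exact absurd hn (not_lt.2 h1)

lemma mem_bigPi_iff (p : (Fin d → ℝ) × (Fin d → ℝ)) :
    p ∈ bigPi d ↔ ∀ N, Summable fun n => minDist N p n ^ d := by
  simp only [bigPi, Set.mem_iInter]
  constructor
  · intro h N
    by_contra hN
    exact notMem_W_of_minDist_le N p (h _ ⟨antitone_minDist N p, hN⟩)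
  · rintro h ψ ⟨hψ, hs⟩
    by_contra hp
    obtain ⟨N, hN⟩ := (Set.not_infinite.1 hp).bddAbove
    refine hs ?_
    have key : ∀ n, N + 1 ≤ n → ψ n ≤ minDist (N + 1) p n := by
      intro n hn
      refine Finset.le_inf' _ _ fun m hm => ?_
      rw [Finset.mem_Icc, max_eq_right hn] at hm
      refine (hψ hm.2).trans ?_
      by_contra hlt
      rw [not_le, ← NNReal.coe_lt_coe, coe_affDist] at hlt
      exact absurd (hN hlt) (not_le.2 (PNat.add_one_le_iff.1 hm.1))
    have hfin : (Set.Iio (N + 1)).Finite := Set.finite_Iio _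
    refine NNReal.summable_coe.1 (Summable.of_norm_bounded_eventually
      (NNReal.summable_coe.2 (h (N + 1))) ?_)
    filter_upwards [hfin.compl_mem_cofinite] with n hn
    rw [Real.norm_of_nonneg (NNReal.coe_nonneg _), NNReal.coe_le_coe]
    exact pow_le_pow_left' (key n (not_lt.1 hn)) d

lemma measurableSet_bigPi (d : ℕ) : MeasurableSet (bigPi d) := by
  have h : bigPi d = ⋂ N : ℕ+, {p | ∑' n, ((minDist N p n ^ d : ℝ≥0) : ENNReal) = ⊤}ᶜ := by
    ext p
    simp only [mem_bigPi_iff, Set.mem_iInter, Set.mem_compl_iff, Set.mem_ofPred_eq]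
    exact forall_congr' fun N => ENNReal.tsum_coe_ne_top_iff_summable.symm
  rw [h]
  refine MeasurableSet.iInter fun N => MeasurableSet.compl ?_
  have hm : Measurable fun p : (Fin d → ℝ) × (Fin d → ℝ) =>
      ∑' n, ((minDist N p n ^ d : ℝ≥0) : ENNReal) :=
    Measurable.tsum fun n => ((continuous_minDist N n).pow d).measurable.coe_nnreal_ennreal
  exact hm (measurableSet_singleton _)

lemma volume_distInt_lt_le (v : Fin d → ℝ) {r : ℝ} (h0 : 0 < r) (h1 : r ≤ 1) (R : ℕ) :
    volume ({y | distInt (v + y) < r} ∩ closedBall 0 (R : ℝ)) ≤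
      ((2 * R + 5) ^ d : ℕ) * ENNReal.ofReal ((2 * r) ^ d) := by
  set K : Finset (Fin d → ℤ) :=
    Fintype.piFinset fun _ => Finset.Icc (-(R + 2) : ℤ) (R + 2) with hK
  have hcard : K.card = (2 * R + 5) ^ d := by
    rw [hK, Fintype.card_piFinset]
    simp only [Int.card_Icc, Finset.prod_const, Finset.card_univ, Fintype.card_fin]
    congr 1
    omega
  have hsub : {y | distInt (v + y) < r} ∩ closedBall 0 (R : ℝ) ⊆
      ⋃ k ∈ K, ball (fun i => (k i : ℝ) - Int.fract (v i)) r := by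
    rintro y ⟨hy, hyR⟩
    obtain ⟨_, ⟨k, rfl⟩, hk⟩ := (infDist_lt_iff (Set.range_nonempty _)).1 hy
    rw [dist_pi_lt_iff h0] at hk
    rw [mem_closedBall, dist_pi_le_iff (Nat.cast_nonneg R)] at hyR
    simp only [Set.mem_iUnion, exists_prop]
    -- Subtracting the floor makes the count independent of `v`: the coordinates are at most `R + 1
    -- + 1` in absolute value, from `y`, `r ≤ 1` and the fractional part.
    refine ⟨fun i => k i - ⌊v i⌋, ?_, ?_⟩
    · rw [hK, Fintype.mem_piFinset]
      intro i
      have a := hk i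
      have b := hyR i
      rw [Real.dist_eq, abs_lt] at a
      rw [Real.dist_eq, abs_le] at b
      simp only [Pi.add_apply, Pi.zero_apply, sub_zero] at a b
      have c := Int.floor_le (v i)
      have e := Int.lt_floor_add_one (v i)
      rw [Finset.mem_Icc]
      constructor
      · have : (-(R + 2) : ℝ) ≤ k i - ⌊v i⌋ := by linarith
        exact_mod_cast this
      · have : (k i - ⌊v i⌋ : ℝ) ≤ R + 2 := by linarith
        exact_mod_cast this
    · rw [mem_ball, dist_pi_lt_iff h0]
      intro i
      convert hk i using 1
      rw [Real.dist_eq, Real.dist_eq]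
      congr 1
      have := Int.floor_add_fract (v i)
      simp only [Pi.add_apply, Int.cast_sub]
      linarith
  calc _ ≤ volume (⋃ k ∈ K, ball (fun i => (k i : ℝ) - Int.fract (v i)) r) := measure_mono hsub
    _ ≤ ∑ k ∈ K, volume (ball (fun i => (k i : ℝ) - Int.fract (v i)) r) :=
      measure_biUnion_finset_le _ _
    _ = _ := by
      simp only [Real.volume_pi_ball _ h0, Fintype.card_fin, Finset.sum_const, hcard, nsmul_eq_mul]

/-- A union bound over `m ≤ n` with radius `r`, `r ^ d = c / n`: the `n` terms cancel the
denominator. -/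
lemma volume_mul_minDist_pow_lt_le (hd : d ≠ 0) (x : Fin d → ℝ) (R : ℕ) (n : ℕ+) {c : ℝ≥0}
    (h0 : 0 < c) (h1 : c ≤ 1) :
    volume ({y | (n : ℝ≥0) * minDist 1 (x, y) n ^ d < c} ∩ closedBall 0 (R : ℝ)) ≤
      (((2 * R + 5) ^ d * 2 ^ d : ℕ) : ENNReal) * c := by
  have hn : (0 : ℝ) < n := by exact_mod_cast n.pos
  have hn1 : (1 : ℝ) ≤ n := by exact_mod_cast n.pos
  set r : ℝ := (c / n : ℝ) ^ ((d : ℝ)⁻¹) with hr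
  have hc0 : (0 : ℝ) < c := h0
  have hc1 : (c : ℝ) ≤ 1 := h1
  have hcn : (0 : ℝ) < c / n := by positivity
  have hr0 : 0 < r := Real.rpow_pos_of_pos hcn _
  have hrd : r ^ d = c / n := Real.rpow_inv_natCast_pow hcn.le hd
  have hr1 : r ≤ 1 :=
    Real.rpow_le_one hcn.le (div_le_one_of_le₀ (hc1.trans hn1) hn.le) (by positivity)
  have hsub : {y | (n : ℝ≥0) * minDist 1 (x, y) n ^ d < c} ∩ closedBall 0 (R : ℝ) ⊆
      ⋃ m ∈ Finset.Icc 1 n,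
        ({y | distInt (((m : ℕ) : ℝ) • x + y) < r} ∩ closedBall 0 (R : ℝ)) := by
    rintro y ⟨hy, hyR⟩
    obtain ⟨m, hm, he⟩ := Finset.exists_mem_eq_inf'
      (Finset.nonempty_Icc.2 (le_max_left 1 n)) (affDist (x, y))
    rw [max_eq_right (one_le : 1 ≤ n)] at hm
    simp only [Set.mem_iUnion, exists_prop]
    refine ⟨m, hm, ?_, hyR⟩
    change (n : ℝ≥0) * minDist 1 (x, y) n ^ d < c at hy
    rw [minDist, he, ← NNReal.coe_lt_coe] at hy
    push_cast at hy
    rw [mul_comm, ← lt_div_iff₀ hn, ← hrd] at hy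
    exact lt_of_pow_lt_pow_left₀ d hr0.le hy
  calc _ ≤ _ := measure_mono hsub
    _ ≤ ∑ m ∈ Finset.Icc 1 n, volume
          ({y | distInt (((m : ℕ) : ℝ) • x + y) < r} ∩ closedBall 0 (R : ℝ)) :=
      measure_biUnion_finset_le _ _
    _ ≤ ∑ m ∈ Finset.Icc 1 n, ((2 * R + 5) ^ d : ℕ) * ENNReal.ofReal ((2 * r) ^ d) :=
      Finset.sum_le_sum fun m _ => volume_distInt_lt_le _ hr0 hr1 R
    _ = _ := by
      rw [Finset.sum_const, PNat.card_Icc, mul_pow, hrd]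
      have e : (c : ENNReal) = ENNReal.ofReal (c : ℝ) := (ENNReal.ofReal_coe_nnreal).symm
      simp only [nsmul_eq_mul, PNat.one_coe, Nat.add_sub_cancel, e, ← ENNReal.ofReal_natCast]
      rw [← ENNReal.ofReal_mul (by positivity), ← ENNReal.ofReal_mul (by positivity),
        ← ENNReal.ofReal_mul (by positivity)]
      congr 1
      push_cast
      field_simp

/-- Cauchy condensation: these are the terms of a convergent series. -/
lemma tendsto_two_pow_mul_of_antitone_of_summable {a : ℕ+ → ℝ≥0} (ha : Antitone a)
    (hs : Summable a) : Tendsto (fun k : ℕ => (2 : ℝ≥0) ^ k * a (2 ^ k)) atTop (𝓝 0) := by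
  -- `toPNat'` sends `0` to `1`; that extra term is harmless.
  have hf : Summable fun n : ℕ => a n.toPNat' := by
    refine (NNReal.summable_nat_add_iff 1).1
      ((summable_pnat_iff_summable_succ (f := fun n : ℕ => a n.toPNat')).1 ?_)
    simpa only [PNat.coe_toPNat'] using hs
  have hanti : ∀ ⦃m n : ℕ⦄, 0 < m → m ≤ n → a n.toPNat' ≤ a m.toPNat' := by
    intro m n hm hmn
    refine ha ?_
    rw [← PNat.coe_le_coe, Nat.toPNat'_coe, Nat.toPNat'_coe, if_pos hm, if_pos (hm.trans_le hmn)]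
    exact hmn
  have he (k : ℕ) : (2 ^ k : ℕ).toPNat' = (2 : ℕ+) ^ k := by
    rw [← PNat.coe_toPNat' (2 ^ k), PNat.pow_coe, PNat.val_ofNat]
  have h : Summable fun k : ℕ => (2 : ℝ≥0) ^ k * a (2 ^ k : ℕ).toPNat' :=
    (NNReal.summable_condensed_iff (f := fun n : ℕ => a n.toPNat') hanti).2 hf
  simp only [he] at h
  exact NNReal.tendsto_atTop_zero_of_summable h

lemma volume_Phi_eq_zero (hd : d ≠ 0) (x : Fin d → ℝ) : volume (Phi x) = 0 := by
  have hball (R : ℕ) : volume (Phi x ∩ closedBall 0 (R : ℝ)) = 0 := by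
    set C : ℕ := (2 * R + 5) ^ d * 2 ^ d
    have hle (c : ℝ≥0) (h0 : 0 < c) (h1 : c ≤ 1) :
        volume (Phi x ∩ closedBall 0 (R : ℝ)) ≤ (C : ENNReal) * c := by
      set s : ℕ → Set (Fin d → ℝ) := fun K => ⋂ k ≥ K,
        ({y | ((2 ^ k : ℕ+) : ℝ≥0) * minDist 1 (x, y) (2 ^ k) ^ d < c} ∩ closedBall 0 (R : ℝ))
      have hs : Monotone s := fun K L hKL =>
        Set.biInter_subset_biInter_left fun k (hk : L ≤ k) => hKL.trans hk
      have hsub : Phi x ∩ closedBall 0 (R : ℝ) ⊆ ⋃ K, s K := by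
        rintro y ⟨hy, hyR⟩
        have hsum := (mem_bigPi_iff (x, y)).1 hy 1
        have ht := tendsto_two_pow_mul_of_antitone_of_summable
          (fun m n h => pow_le_pow_left' (antitone_minDist 1 (x, y) h) d) hsum
        obtain ⟨K, hK⟩ := eventually_atTop.1 (ht.eventually_lt_const h0)
        refine Set.mem_iUnion.2 ⟨K, Set.mem_iInter₂.2 fun k hk => ⟨?_, hyR⟩⟩
        simpa using hK k hk
      refine (measure_mono hsub).trans ?_
      -- Continuity from below: each `s K` lies in its `k = K` set, whose bound does not depend on
      -- `K`.
      rw [hs.measure_iUnion]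
      exact iSup_le fun K => (measure_mono (Set.biInter_subset_of_mem (le_refl K))).trans
        (volume_mul_minDist_pow_lt_le hd x R (2 ^ K) h0 h1)
    have ht : Tendsto (fun c : ℝ≥0 => (C : ENNReal) * c) (𝓝[>] 0) (𝓝 0) := by
      have : Tendsto (fun c : ℝ≥0 => (C : ENNReal) * c) (𝓝 0) (𝓝 ((C : ENNReal) * (0 : ℝ≥0))) :=
        ENNReal.Tendsto.const_mul (ENNReal.tendsto_coe.2 tendsto_id)
          (Or.inr (ENNReal.natCast_ne_top C))
      simpa using this.mono_left nhdsWithin_le_nhds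
    refine le_antisymm (ge_of_tendsto ht ?_) zero_le
    filter_upwards [Ioc_mem_nhdsGT (zero_lt_one' ℝ≥0)] with c hc using hle c hc.1 hc.2
  have hU : Phi x = ⋃ R : ℕ, Phi x ∩ closedBall 0 (R : ℝ) := by
    rw [← Set.inter_iUnion, iUnion_closedBall_nat, Set.inter_univ]
  rw [hU]
  exact measure_iUnion_null hball

lemma measurableSet_Phi (x : Fin d → ℝ) : MeasurableSet (Phi x) :=
  measurable_prodMk_left (measurableSet_bigPi d)

lemma volume_bigPi_eq_zero (hd : d ≠ 0) : volume (bigPi d) = 0 :=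
  (Measure.measure_prod_null (measurableSet_bigPi d)).2
    (Eventually.of_forall (volume_Phi_eq_zero hd))

end InhomApprox

theorem theorem2 (d : ℕ) (hd : 1 ≤ d) :
    (MeasureTheory.AnalyticSet (InhomApprox.bigPi d)ᶜ ∧
      MeasureTheory.NullMeasurableSet (InhomApprox.bigPi d)
        (MeasureTheory.volume : MeasureTheory.Measure ((Fin d → ℝ) × (Fin d → ℝ))) ∧
      (MeasureTheory.volume : MeasureTheory.Measure ((Fin d → ℝ) × (Fin d → ℝ)))
        (InhomApprox.bigPi d) = 0) ∧
    ∀ x : Fin d → ℝ,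
      MeasureTheory.AnalyticSet (InhomApprox.Phi x)ᶜ ∧
      MeasureTheory.NullMeasurableSet (InhomApprox.Phi x)
        (MeasureTheory.volume : MeasureTheory.Measure (Fin d → ℝ)) ∧
      (MeasureTheory.volume : MeasureTheory.Measure (Fin d → ℝ)) (InhomApprox.Phi x) = 0 := by
  have hd' : d ≠ 0 := by omega
  have hP := InhomApprox.measurableSet_bigPi d
  exact ⟨⟨hP.compl.analyticSet, hP.nullMeasurableSet, InhomApprox.volume_bigPi_eq_zero hd'⟩,
    fun x => ⟨(InhomApprox.measurableSet_Phi x).compl.analyticSet,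
      (InhomApprox.measurableSet_Phi x).nullMeasurableSet, InhomApprox.volume_Phi_eq_zero hd' x⟩⟩
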